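/- Let $m,n$ be positive integers, let $\alpha_1,\dots,\alpha_n$ be linear forms on $\mathbb{R}^m$, and let $\mathbb{R}^m$ act on $\mathbb{C}^n$ by $t\cdot z=(e^{i\alpha_1(t)}z_1,\dots,e^{i\alpha_n(t)}z_n)$; write $t^{-1}\cdot z$ for $(-t)\cdot z$. For $z,w\in\mathbb{C}^n$ put $zw=\sum_k z_kw_k$, $|z|^2=z\bar z$, and $\omega((z,w),(z',w'))=\tfrac{i}{2}(zw'-z'w)$. Let $H_n=\mathbb{C}^n\times\mathbb{R}$ be the Heisenberg group with $(z,c)\cdot(z',c')=(z+z',\,c+c'+\tfrac12\omega((z,\bar z),(z',\bar z')))$, and let $G=\mathbb{R}^m\ltimes H_n$ be the generalized diamond group, that is $\mathbb{R}^m\times\mathbb{C}^n\times\mathbb{R}$ with $$(t,z,c)\cdot(t',z',c')=\bigl(t+t',\;z+t\cdot z',\;c+c'+\tfrac12\omega((z,\bar z),(t\cdot z',\overline{t\cdot z'}))\bigr).$$ Let $\lambda>0$, let $\mathcal{F}_\lambda$ be the Fock space of all holomorphic functions $f$ on $\mathbb{C}^n$ with $\|f\|_\lambda^2=\int_{\mathbb{C}^n}|f(z)|^2e^{-\lambda|z|^2/2}\,d\mu_\lambda(z)<\infty$,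 where $d\mu_\lambda=(2\pi)^{-n}\lambda^n\,dm$ and $m$ is Lebesgue measure, and let $\rho_\lambda$ be the representation of $H_n$ on $\mathcal{F}_\lambda$ given by $$(\rho_\lambda(z_0,c_0)f)(z)=\exp\!\left(i\lambda c_0+\tfrac{\lambda}{2}\bar z_0z-\tfrac{\lambda}{4}|z_0|^2\right)f(z-z_0).$$ For each $t\in\mathbb{R}^m$ let $\sigma(t)$ be a linear operator on $\mathcal{F}_\lambda$. Then $$\pi(t,h)=\rho_\lambda(h)\sigma(t),\qquad t\in\mathbb{R}^m,\ h\in H_n,$$ defines a (strongly continuous) unitary representation of $G$ on $\mathcal{F}_\lambda$ if and only if there exists a unitary character $\chi$ of $\mathbb{R}^m$ (a continuous homomorphism from $\mathbb{R}^m$ to the unit circle) such that $$(\sigma(t)f)(z)=\chi(t)f(t^{-1}\cdot z)$$ for all $t\in\mathbb{R}^m$, $f\in\mathcal{F}_\lambda$, $z\in\mathbb{C}^n$. In this case, $$(\pi(t,z_0,c_0)f)(z)=\chi(t)\exp\!\left(i\lambda c_0+\tfrac{\lambda}{2}\bar z_0z-\tfrac{\lambda}{4}|z_0|^2\right)f(t^{-1}\cdot(z-z_0))$$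 for all $t\in\mathbb{R}^m$, $z,z_0\in\mathbb{C}^n$, $c_0\in\mathbb{R}$ and $f\in\mathcal{F}_\lambda$. -/

import Mathlib

open MeasureTheory Matrix

noncomputable section

/-! ### The Heisenberg group -/

/-- The form `ω((z,w),(z',w')) = (i/2) (z w' - z' w)`, where `z w = ∑ k, z k * w k`. -/
def omega {n : ℕ} (p q : (Fin n → ℂ) × (Fin n → ℂ)) : ℂ :=
  Complex.I / 2 * (p.1 ⬝ᵥ q.2 - q.1 ⬝ᵥ p.2)

/-- The value `ω((z, z̄), (z', z̄'))` as a real number (it is real by `omega_star_im`). -/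
def omegaRe {n : ℕ} (z z' : Fin n → ℂ) : ℝ :=
  (omega (z, star z) (z', star z')).re

theorem omegaRe_eq {n : ℕ} (z z' : Fin n → ℂ) :
    omegaRe z z' = -(z ⬝ᵥ star z').im := by
  have h : z' ⬝ᵥ star z = star (z ⬝ᵥ star z') := by
    simp [dotProduct, mul_comm]
  simp only [omegaRe, omega, h]
  simp [Complex.mul_re]
  ring

theorem omega_star_im {n : ℕ} (z z' : Fin n → ℂ) :
    (omega (z, star z) (z', star z')).im = 0 := by
  have h : z' ⬝ᵥ star z = star (z ⬝ᵥ star z') := by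
    simp [dotProduct, mul_comm]
  simp only [omega, h]
  simp [Complex.mul_im]

/-- The `(2n+1)`-dimensional real Heisenberg group `H_n`, with elements `(z, c)`. -/
@[ext]
structure Heisenberg (n : ℕ) where
  z : Fin n → ℂ
  c : ℝ

namespace Heisenberg

variable {n : ℕ}

instance : Mul (Heisenberg n) :=
  ⟨fun a b => ⟨a.z + b.z, a.c + b.c + 1 / 2 * omegaRe a.z b.z⟩⟩

instance : One (Heisenberg n) := ⟨⟨0, 0⟩⟩

instance : Inv (Heisenberg n) := ⟨fun a => ⟨-a.z, -a.c⟩⟩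

@[simp] theorem mul_z (a b : Heisenberg n) : (a * b).z = a.z + b.z := rfl
@[simp] theorem mul_c (a b : Heisenberg n) :
    (a * b).c = a.c + b.c + 1 / 2 * omegaRe a.z b.z := rfl
@[simp] theorem one_z : (1 : Heisenberg n).z = 0 := rfl
@[simp] theorem one_c : (1 : Heisenberg n).c = 0 := rfl
@[simp] theorem inv_z (a : Heisenberg n) : (a⁻¹).z = -a.z := rfl
@[simp] theorem inv_c (a : Heisenberg n) : (a⁻¹).c = -a.c := rfl

instance : Group (Heisenberg n) :=
  Group.ofLeftAxioms
    (fun a b c => by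
      ext1
      · simp [add_assoc]
      · simp [omegaRe_eq, add_dotProduct, dotProduct_add]
        ring)
    (fun a => by ext1 <;> simp [omegaRe_eq])
    (fun a => by
      ext1
      · simp
      · have : (a.z ⬝ᵥ star a.z).im = 0 := by
          simp [dotProduct, Complex.mul_im, mul_comm]
        simp [omegaRe_eq, this])

end Heisenberg

/-! ### The generalized diamond group -/

/-- The action `t · z = (e^{i α₁(t)} z₁, …, e^{i αₙ(t)} zₙ)` of `ℝ^m` on `ℂ^n`. -/
def act {m n : ℕ} (α : Fin n → ((Fin m → ℝ) →ₗ[ℝ] ℝ)) (t : Fin m → ℝ) (z : Fin n → ℂ) :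
    Fin n → ℂ :=
  fun k => Complex.exp (Complex.I * (α k t : ℂ)) * z k

/-- The action `t · (z, c) = (t · z, c)` of `ℝ^m` on `H_n`. -/
def actH {m n : ℕ} (α : Fin n → ((Fin m → ℝ) →ₗ[ℝ] ℝ)) (t : Fin m → ℝ) (h : Heisenberg n) :
    Heisenberg n :=
  ⟨act α t h.z, h.c⟩

section action

variable {m n : ℕ} (α : Fin n → ((Fin m → ℝ) →ₗ[ℝ] ℝ))

theorem act_zero (z : Fin n → ℂ) : act α 0 z = z := by
  ext k; simp [act]

theorem act_act (s t : Fin m → ℝ) (z : Fin n → ℂ) : act α s (act α t z) = act α (s + t) z := by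
  ext k
  simp only [act, map_add, Complex.ofReal_add, mul_add, Complex.exp_add, mul_assoc]

theorem act_add (t : Fin m → ℝ) (z w : Fin n → ℂ) :
    act α t (z + w) = act α t z + act α t w := by
  ext k; simp [act, mul_add]

theorem omegaRe_act (t : Fin m → ℝ) (z w : Fin n → ℂ) :
    omegaRe (act α t z) (act α t w) = omegaRe z w := by
  have : act α t z ⬝ᵥ star (act α t w) = z ⬝ᵥ star w := by
    unfold dotProduct
    refine Finset.sum_congr rfl fun k _ => ?_
    have h : Complex.exp (Complex.I * (α k t : ℂ)) *
        (starRingEnd ℂ) (Complex.exp (Complex.I * (α k t : ℂ))) = 1 := by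
      rw [← Complex.exp_conj, ← Complex.exp_add]
      simp
    simp only [act, Pi.star_apply, RCLike.star_def, map_mul]
    linear_combination (z k * (starRingEnd ℂ) (w k)) * h
  rw [omegaRe_eq, omegaRe_eq, this]

theorem actH_zero (h : Heisenberg n) : actH α 0 h = h := by
  ext1 <;> simp [actH, act_zero]

theorem actH_actH (s t : Fin m → ℝ) (h : Heisenberg n) :
    actH α s (actH α t h) = actH α (s + t) h := by
  ext1 <;> simp [actH, act_act]

theorem actH_mul (t : Fin m → ℝ) (h k : Heisenberg n) :
    actH α t (h * k) = actH α t h * actH α t k := by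
  ext1 <;> simp [actH, act_add, omegaRe_act]

theorem actH_one (t : Fin m → ℝ) : actH α t (1 : Heisenberg n) = 1 := by
  ext1
  · ext k; simp [actH, act]
  · simp [actH]

end action

/-- The generalized diamond group `G = ℝ^m ⋉ H_n` determined by the linear forms `α`,
with elements `(t, h) = (t, (z, c))`. -/
@[ext]
structure Diamond {m n : ℕ} (α : Fin n → ((Fin m → ℝ) →ₗ[ℝ] ℝ)) where
  t : Fin m → ℝ
  h : Heisenberg n

namespace Diamond

variable {m n : ℕ} {α : Fin n → ((Fin m → ℝ) →ₗ[ℝ] ℝ)}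

/-- The semidirect product law `(t, h) (t', h') = (t + t', h (t · h'))`. -/
instance : Mul (Diamond α) := ⟨fun a b => ⟨a.t + b.t, a.h * actH α a.t b.h⟩⟩

instance : One (Diamond α) := ⟨⟨0, 1⟩⟩

instance : Inv (Diamond α) := ⟨fun a => ⟨-a.t, actH α (-a.t) a.h⁻¹⟩⟩

@[simp] theorem mul_t (a b : Diamond α) : (a * b).t = a.t + b.t := rfl
@[simp] theorem mul_h (a b : Diamond α) : (a * b).h = a.h * actH α a.t b.h := rfl
@[simp] theorem one_t : (1 : Diamond α).t = 0 := rfl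
@[simp] theorem one_h : (1 : Diamond α).h = 1 := rfl
@[simp] theorem inv_t (a : Diamond α) : (a⁻¹).t = -a.t := rfl
@[simp] theorem inv_h (a : Diamond α) : (a⁻¹).h = actH α (-a.t) a.h⁻¹ := rfl

/-- The law written on triples. -/
theorem mk_mul_mk (t t' : Fin m → ℝ) (z z' : Fin n → ℂ) (c c' : ℝ) :
    (⟨t, ⟨z, c⟩⟩ * ⟨t', ⟨z', c'⟩⟩ : Diamond α) =
      ⟨t + t', ⟨z + act α t z', c + c' + 1 / 2 * omegaRe z (act α t z')⟩⟩ := rfl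

instance : Group (Diamond α) :=
  Group.ofLeftAxioms
    (fun a b c => by
      apply Diamond.ext
      · simp [add_assoc]
      · simp [actH_mul, actH_actH, mul_assoc])
    (fun a => by apply Diamond.ext <;> simp [actH_zero])
    (fun a => by
      apply Diamond.ext
      · simp
      · simp [← actH_mul, actH_one])

/-- The topology of `ℝ^m × ℂ^n × ℝ`. -/
instance : TopologicalSpace (Diamond α) :=
  TopologicalSpace.induced (fun g => (g.t, g.h.z, g.h.c)) inferInstance

end Diamond

/-! ### The Fock space -/

/-- `|z|² = ∑ k, |z k|²` on `ℂ^n`. -/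
def absSq {n : ℕ} (z : Fin n → ℂ) : ℝ := ∑ k, ‖z k‖ ^ 2

/-- The measure `dμ_λ(z) = (2π)^{-n} λ^n dm(z)` on `ℂ^n`, `m` being Lebesgue measure. -/
def muFock (n : ℕ) (lam : ℝ) : Measure (Fin n → ℂ) :=
  ENNReal.ofReal (((2 * Real.pi) ^ n)⁻¹ * lam ^ n) • volume

/-- The entire functions `f` on `ℂ^n` with `∫ |f|² e^{-λ|z|²/2} dμ_λ < ∞`, as a subspace of all
functions. -/
def fockSubmodule (n : ℕ) (lam : ℝ) : Submodule ℂ ((Fin n → ℂ) → ℂ) where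
  carrier := {f | Differentiable ℂ f ∧
    Integrable (fun z => ‖f z‖ ^ 2 * Real.exp (-lam * absSq z / 2)) (muFock n lam)}
  zero_mem' := by
    refine ⟨differentiable_const 0, ?_⟩
    simp
  add_mem' := by
    rintro f g ⟨hf, hf'⟩ ⟨hg, hg'⟩
    refine ⟨hf.add hg, ((hf'.add hg').const_mul 2).mono' ?_ ?_⟩
    · have h1 := hf.continuous
      have h2 := hg.continuous
      exact ((h1.add h2).norm.pow 2 |>.mul (by unfold absSq; fun_prop)).aestronglyMeasurable
    · refine Filter.Eventually.of_forall fun z => ?_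
      have h := norm_add_le (f z) (g z)
      have h0 := norm_nonneg (f z + g z)
      have h3 : ‖f z + g z‖ ^ 2 ≤ 2 * (‖f z‖ ^ 2 + ‖g z‖ ^ 2) := by
        nlinarith [sq_nonneg (‖f z‖ - ‖g z‖)]
      have h4 := mul_le_mul_of_nonneg_right h3 (Real.exp_pos (-lam * absSq z / 2)).le
      rw [Real.norm_of_nonneg (by positivity)]
      simp only [Pi.add_apply]
      linarith
  smul_mem' := by
    rintro c f ⟨hf, hf'⟩
    refine ⟨hf.const_smul c, ?_⟩
    convert hf'.const_mul (‖c‖ ^ 2) using 2 with z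
    simp only [Pi.smul_apply, smul_eq_mul, norm_mul]
    ring

/-- The Fock space `F_λ` (a type of its own, so that its only topology is that of its norm). -/
def Fock (n : ℕ) (lam : ℝ) : Type := fockSubmodule n lam

namespace Fock

variable {n : ℕ} {lam : ℝ}

instance : AddCommGroup (Fock n lam) := inferInstanceAs (AddCommGroup (fockSubmodule n lam))
instance : Module ℂ (Fock n lam) := inferInstanceAs (Module ℂ (fockSubmodule n lam))

instance : FunLike (Fock n lam) (Fin n → ℂ) ℂ where
  coe f := f.1
  coe_injective := Subtype.val_injective

@[ext] theorem ext {f g : Fock n lam} (h : ∀ z, f z = g z) : f = g := DFunLike.ext _ _ h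

@[simp] theorem add_apply (f g : Fock n lam) (z : Fin n → ℂ) : (f + g) z = f z + g z := rfl
@[simp] theorem smul_apply (a : ℂ) (f : Fock n lam) (z : Fin n → ℂ) : (a • f) z = a * f z := rfl
@[simp] theorem zero_apply (z : Fin n → ℂ) : (0 : Fock n lam) z = 0 := rfl

theorem differentiable (f : Fock n lam) : Differentiable ℂ f := f.2.1

theorem integrable (f : Fock n lam) :
    Integrable (fun z => ‖f z‖ ^ 2 * Real.exp (-lam * absSq z / 2)) (muFock n lam) := f.2.2

/-- The inner product `∫ conj(f) g e^{-λ|z|²/2} dμ_λ` (conjugate-linear in the first variable,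
as everywhere in the library). -/
instance : Inner ℂ (Fock n lam) where
  inner f g := ∫ z, (starRingEnd ℂ) (f z) * g z * (Real.exp (-lam * absSq z / 2) : ℂ)
    ∂(muFock n lam)

theorem inner_def (f g : Fock n lam) : inner ℂ f g =
    ∫ z, (starRingEnd ℂ) (f z) * g z * (Real.exp (-lam * absSq z / 2) : ℂ) ∂(muFock n lam) := rfl

theorem integrable_inner (f g : Fock n lam) :
    Integrable (fun z => (starRingEnd ℂ) (f z) * g z * (Real.exp (-lam * absSq z / 2) : ℂ))
      (muFock n lam) := by
  refine (f.integrable.add g.integrable).mono' ?_ ?_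
  · have h1 := f.differentiable.continuous
    have h2 := g.differentiable.continuous
    refine Continuous.aestronglyMeasurable ?_
    unfold absSq
    fun_prop
  · refine Filter.Eventually.of_forall fun z => ?_
    have h3 : ‖f z‖ * ‖g z‖ ≤ ‖f z‖ ^ 2 + ‖g z‖ ^ 2 := by
      nlinarith [sq_nonneg (‖f z‖ - ‖g z‖), sq_nonneg (‖f z‖), sq_nonneg (‖g z‖)]
    have h4 := mul_le_mul_of_nonneg_right h3 (Real.exp_pos (-lam * absSq z / 2)).le
    rw [norm_mul, norm_mul, RCLike.norm_conj, Complex.norm_real,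
      Real.norm_of_nonneg (Real.exp_pos _).le]
    simp only [Pi.add_apply]
    linarith

theorem inner_self (f : Fock n lam) : inner ℂ f f =
    ((∫ z, ‖f z‖ ^ 2 * Real.exp (-lam * absSq z / 2) ∂(muFock n lam) : ℝ) : ℂ) := by
  rw [inner_def, ← integral_complex_ofReal]
  congr 1
  ext z
  rw [Complex.conj_mul']
  push_cast
  ring

theorem inner_self_eq_zero [hl : Fact (0 < lam)] (f : Fock n lam) (h : inner ℂ f f = 0) :
    f = 0 := by
  rw [inner_self, Complex.ofReal_eq_zero] at h
  have hc : (0 : ℝ) < ((2 * Real.pi) ^ n)⁻¹ * lam ^ n := by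
    have := hl.out
    positivity
  have hpos : ∀ z, 0 ≤ ‖f z‖ ^ 2 * Real.exp (-lam * absSq z / 2) := fun z => by positivity
  rw [muFock, integral_smul_measure, smul_eq_zero, ENNReal.toReal_ofReal hc.le] at h
  have h1 := h.resolve_left hc.ne'
  have hint := f.integrable
  rw [muFock, integrable_smul_measure (by simpa using hc) ENNReal.ofReal_ne_top] at hint
  have hcont := f.differentiable.continuous
  rw [integral_eq_zero_iff_of_nonneg hpos hint] at h1
  have h2 := (Continuous.ae_eq_iff_eq (μ := volume) (by unfold absSq; fun_prop)
    continuous_zero).1 h1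
  ext z
  have h3 := congrFun h2 z
  simpa [(Real.exp_pos _).ne'] using h3

/-- The Hilbert norm of `F_λ`. -/
@[reducible] def core [Fact (0 < lam)] : InnerProductSpace.Core ℂ (Fock n lam) where
  conj_inner_symm f g := by
    rw [inner_def, inner_def, ← integral_conj]
    congr 1
    ext z
    simp only [map_mul, Complex.conj_conj, Complex.conj_ofReal]
    ring
  re_inner_nonneg f := by
    rw [inner_self]
    exact integral_nonneg fun z => by positivity
  add_left f g h := by
    rw [inner_def, inner_def, inner_def,
      ← integral_add (integrable_inner f h) (integrable_inner g h)]
    congr 1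
    ext z
    simp only [add_apply, map_add]
    ring
  smul_left f g a := by
    rw [inner_def, inner_def, ← integral_const_mul]
    congr 1
    ext z
    simp only [smul_apply, map_mul]
    ring
  definite f := inner_self_eq_zero f

instance [Fact (0 < lam)] : NormedAddCommGroup (Fock n lam) :=
  core.toNormedAddCommGroup

instance [Fact (0 < lam)] : InnerProductSpace ℂ (Fock n lam) :=
  InnerProductSpace.ofCore core.toCore

end Fock

/-! ### The representation `ρ_λ` of the Heisenberg group -/

/-- `ρ_λ(z₀,c₀) f (z) = exp(iλc₀ + (λ/2) z̄₀ z - (λ/4)|z₀|²) f(z - z₀)`, on functions. -/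
def rhoFun {n : ℕ} (lam : ℝ) (h : Heisenberg n) (f : (Fin n → ℂ) → ℂ) (z : Fin n → ℂ) : ℂ :=
  Complex.exp (Complex.I * lam * h.c + lam / 2 * (star h.z ⬝ᵥ z) - lam / 4 * absSq h.z)
    * f (z - h.z)

theorem absSq_sub {n : ℕ} (z w : Fin n → ℂ) :
    absSq (z - w) = absSq z - 2 * (star w ⬝ᵥ z).re + absSq w := by
  simp only [absSq, dotProduct, Complex.re_sum, Finset.mul_sum, ← Finset.sum_sub_distrib,
    ← Finset.sum_add_distrib]
  refine Finset.sum_congr rfl fun k _ => ?_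
  simp only [Complex.sq_norm, Complex.normSq_apply, Pi.sub_apply, Complex.sub_re, Complex.sub_im,
    Pi.star_apply, RCLike.star_def, Complex.mul_re, Complex.conj_re, Complex.conj_im]
  ring

theorem rhoFun_mem {n : ℕ} (lam : ℝ) (h : Heisenberg n) (f : (Fin n → ℂ) → ℂ)
    (hf : f ∈ fockSubmodule n lam) : rhoFun lam h f ∈ fockSubmodule n lam := by
  obtain ⟨hd, hi⟩ := hf
  refine ⟨?_, ?_⟩
  · unfold rhoFun dotProduct
    fun_prop
  · rw [muFock] at hi ⊢
    by_cases h0 : ENNReal.ofReal (((2 * Real.pi) ^ n)⁻¹ * lam ^ n) = 0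
    · rw [h0, zero_smul]
      exact integrable_zero_measure
    rw [integrable_smul_measure h0 ENNReal.ofReal_ne_top] at hi ⊢
    refine (hi.comp_sub_right h.z).congr (Filter.Eventually.of_forall fun z => Eq.symm ?_)
    show ‖rhoFun lam h f z‖ ^ 2 * _ = ‖f (z - h.z)‖ ^ 2 * _
    rw [rhoFun, norm_mul, mul_pow, Complex.norm_exp, ← Real.exp_nat_mul, mul_right_comm,
      ← Real.exp_add, mul_comm, absSq_sub]
    congr 2
    have e1 : (Complex.I * lam * h.c).re = 0 := by simp
    have e2 : ((lam : ℂ) / 2 * (star h.z ⬝ᵥ z)).re = lam / 2 * (star h.z ⬝ᵥ z).re := by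
      rw [show (lam : ℂ) / 2 = ((lam / 2 : ℝ) : ℂ) by push_cast; rfl, Complex.re_ofReal_mul]
    have e3 : ((lam : ℂ) / 4 * absSq h.z).re = lam / 4 * absSq h.z := by
      rw [show (lam : ℂ) / 4 = ((lam / 4 : ℝ) : ℂ) by push_cast; rfl, Complex.re_ofReal_mul,
        Complex.ofReal_re]
    rw [Complex.sub_re, Complex.add_re, e1, e2, e3]
    push_cast
    ring

/-- The Bargmann-Fock operators `ρ_λ(h)` on `F_λ`. -/
def rho {n : ℕ} (lam : ℝ) (h : Heisenberg n) : Fock n lam →ₗ[ℂ] Fock n lam where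
  toFun f := ⟨rhoFun lam h f, rhoFun_mem lam h f f.2⟩
  map_add' f g := by
    ext z
    exact mul_add _ _ _
  map_smul' a f := by
    ext z
    exact mul_left_comm _ _ _

theorem rho_apply {n : ℕ} (lam : ℝ) (h : Heisenberg n) (f : Fock n lam) (z : Fin n → ℂ) :
    rho lam h f z = Complex.exp (Complex.I * lam * h.c + lam / 2 * (star h.z ⬝ᵥ z)
      - lam / 4 * absSq h.z) * f (z - h.z) := rfl

/-! ### Unitary representations -/

/-- A family of operators is a unitary representation: a homomorphism into the unitary operators
(surjective linear isometries) which is strongly continuous. -/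
structure IsUnitaryRep {G H : Type*} [Group G] [TopologicalSpace G] [NormedAddCommGroup H]
    [InnerProductSpace ℂ H] (π : G → (H →ₗ[ℂ] H)) : Prop where
  map_one : π 1 = LinearMap.id
  map_mul : ∀ g g', π (g * g') = π g ∘ₗ π g'
  unitary : ∀ g, ∃ U : H ≃ₗᵢ[ℂ] H, ∀ f, π g f = U f
  continuous : ∀ f, Continuous fun g => π g f

/-- The operators `π(t, h) = ρ_λ(h) σ(t)`. -/
def piOp {m n : ℕ} (α : Fin n → ((Fin m → ℝ) →ₗ[ℝ] ℝ)) (lam : ℝ)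
    (σ : (Fin m → ℝ) → (Fock n lam →ₗ[ℂ] Fock n lam)) (g : Diamond α) :
    Fock n lam →ₗ[ℂ] Fock n lam :=
  rho lam g.h ∘ₗ σ g.t

end

open Filter Topology

/-! ### Norm convergence in the Fock space -/

namespace Fock

variable {n : ℕ} {lam : ℝ}

/-! The rotations `tau t : f ↦ f(t⁻¹ · z)` are unitary and satisfy the covariance `tau t ∘ rho h =
rho (t · h) ∘ tau t` (`tau_rho`). If `π` is a representation, `σ t` satisfies the same relation, so
`tau (-t) ∘ σ t` is a unitary operator commuting with every `rho h`. Schur's lemma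
(`exists_eq_smul_of_commute_rho`) makes it a scalar `χ t`, which is multiplicative and continuous
because `π` is. Conversely, covariance gives the group law, and strong continuity follows from
pointwise continuity since all norms are preserved (`tendsto_of_pointwise_of_norm_eq`).

Schur's lemma is proved with coherent states: by the mean value property the constant function `1`
represents evaluation at `0` up to a factor, hence its translates `rho (w, 0) 1` represent
evaluation at `w` (`inner_rho_vacuum`). For a commuting unitary `U` this makes `U 1` both
holomorphic and antiholomorphic, hence constant. -/

@[simp] theorem sub_apply (f g : Fock n lam) (z : Fin n → ℂ) : (f - g) z = f z - g z := rfl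

theorem norm_sq_eq [Fact (0 < lam)] (f : Fock n lam) :
    ‖f‖ ^ 2 = ∫ z, ‖f z‖ ^ 2 * Real.exp (-lam * absSq z / 2) ∂(muFock n lam) := by
  have h := inner_self f
  rw [inner_self_eq_norm_sq_to_K] at h
  exact Complex.ofReal_injective (by simpa using h)

/-- Pointwise convergence together with equality of norms implies convergence in norm. -/
theorem tendsto_of_pointwise_of_norm_eq [Fact (0 < lam)] {ι : Type*} {l : Filter ι}
    [l.IsCountablyGenerated] {F : ι → Fock n lam} {f : Fock n lam}
    (hF : ∀ z, Tendsto (fun i => F i z) l (𝓝 (f z))) (hn : ∀ i, ‖F i‖ = ‖f‖) :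
    Tendsto F l (𝓝 f) := by
  set w : (Fin n → ℂ) → ℝ := fun z => Real.exp (-lam * absSq z / 2)
  have hwpos : ∀ z, 0 < w z := fun z => Real.exp_pos _
  -- The subtracted term integrates to zero because the norms agree, and `‖a - b‖² ≤ 2‖a‖² + 2‖b‖²`
  -- bounds what remains above by `4‖f‖²w`, independently of `i`. There is no such bound below, so
  -- dominated convergence is applied to the positive part.
  let b : ι → (Fin n → ℂ) → ℝ := fun i z =>
    ‖(F i - f) z‖ ^ 2 * w z - 2 * (‖F i z‖ ^ 2 * w z - ‖f z‖ ^ 2 * w z)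
  have hbint : ∀ i, Integrable (b i) (muFock n lam) := fun i =>
    (F i - f).integrable.sub (((F i).integrable.sub f.integrable).const_mul 2)
  have hb : ∀ i, ∫ z, b i z ∂(muFock n lam) = ‖F i - f‖ ^ 2 := fun i => by
    have h1 : ∫ z, b i z ∂(muFock n lam) = ‖F i - f‖ ^ 2 - 2 * (‖F i‖ ^ 2 - ‖f‖ ^ 2) := by
      rw [norm_sq_eq, norm_sq_eq, norm_sq_eq, ← integral_sub (F i).integrable f.integrable,
        ← integral_const_mul, ← integral_sub (F i - f).integrable
          (by exact ((F i).integrable.sub f.integrable).const_mul 2)]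
    rw [h1, hn i]
    ring
  have hmax : Tendsto (fun i => ∫ z, max (b i z) 0 ∂(muFock n lam)) l
      (𝓝 (∫ _, (0 : ℝ) ∂(muFock n lam))) := by
    refine tendsto_integral_filter_of_dominated_convergence
      (fun z => 4 * (‖f z‖ ^ 2 * w z)) ?_ ?_ (f.integrable.const_mul 4) ?_
    · exact Eventually.of_forall fun i => (hbint i).pos_part.aestronglyMeasurable
    · refine Eventually.of_forall fun i => Eventually.of_forall fun z => ?_
      rw [Real.norm_of_nonneg (le_max_right _ _)]
      have h0 := hwpos z
      refine max_le ?_ (by positivity)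
      have h1 := norm_sub_le (F i z) (f z)
      have h2 : ‖F i z - f z‖ ^ 2 ≤ 2 * ‖F i z‖ ^ 2 + 2 * ‖f z‖ ^ 2 := by
        nlinarith [sq_nonneg (‖F i z‖ - ‖f z‖), norm_nonneg (F i z - f z)]
      have h3 := mul_le_mul_of_nonneg_right h2 h0.le
      simp only [b, sub_apply]
      linarith
    · refine Eventually.of_forall fun z => ?_
      have h1 : Tendsto (fun i => b i z) l
          (𝓝 (‖f z - f z‖ ^ 2 * w z - 2 * (‖f z‖ ^ 2 * w z - ‖f z‖ ^ 2 * w z))) :=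
        (((((hF z).sub_const _).norm.pow 2).mul_const _).sub
          (((((hF z).norm.pow 2).mul_const _).sub_const _).const_mul 2))
      have h2 := h1.max (tendsto_const_nhds (x := (0 : ℝ)))
      simpa using h2
  rw [integral_zero] at hmax
  have hsq : Tendsto (fun i => ‖F i - f‖ ^ 2) l (𝓝 0) := by
    refine squeeze_zero (fun i => by positivity) (fun i => ?_) hmax
    rw [← hb i]
    exact integral_mono (hbint i) (hbint i).pos_part fun z => le_max_left _ _
  rw [tendsto_iff_norm_sub_tendsto_zero]
  have := hsq.sqrt
  simpa using this

end Fock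

/-! ### Coordinatewise rotations -/

/-- Each coordinate is rotated by a linear isometry of `ℂ`. Independent angles serve the action of
`ℝ^m`; equal angles serve the mean value property. -/
theorem measurePreserving_circle_mul {n : ℕ} (lam : ℝ) (c : Fin n → Circle) :
    MeasurePreserving (fun (z : Fin n → ℂ) k => (c k : ℂ) * z k)
      (muFock n lam) (muFock n lam) := by
  have h : MeasurePreserving (fun (z : Fin n → ℂ) k => (c k : ℂ) * z k) volume volume :=
    volume_preserving_pi (fun k => by
      exact (rotation (c k)).measurePreserving)
  exact h.smul_measure _

theorem measurableEmbedding_circle_mul {n : ℕ} (c : Fin n → Circle) :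
    MeasurableEmbedding (fun (z : Fin n → ℂ) k => (c k : ℂ) * z k) := by
  refine Continuous.measurableEmbedding (by fun_prop) fun z w h => ?_
  ext k
  exact mul_left_cancel₀ (Circle.coe_ne_zero (c k)) (congrFun h k)

theorem absSq_circle_mul {n : ℕ} (c : Fin n → Circle) (z : Fin n → ℂ) :
    absSq (fun k => (c k : ℂ) * z k) = absSq z := by
  simp only [absSq, norm_mul, Circle.norm_coe, one_mul]

theorem act_eq_circle_mul {m n : ℕ} (α : Fin n → ((Fin m → ℝ) →ₗ[ℝ] ℝ)) (t : Fin m → ℝ)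
    (z : Fin n → ℂ) : act α t z = fun k => (Circle.exp (α k t) : ℂ) * z k := by
  ext k
  simp [act, mul_comm]

theorem absSq_act {m n : ℕ} (α : Fin n → ((Fin m → ℝ) →ₗ[ℝ] ℝ)) (t : Fin m → ℝ)
    (z : Fin n → ℂ) : absSq (act α t z) = absSq z := by
  rw [act_eq_circle_mul, absSq_circle_mul]

theorem act_sub {m n : ℕ} (α : Fin n → ((Fin m → ℝ) →ₗ[ℝ] ℝ)) (t : Fin m → ℝ)
    (z w : Fin n → ℂ) : act α t (z - w) = act α t z - act α t w := by
  ext k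
  simp [act, mul_sub]

theorem star_act_dotProduct {m n : ℕ} (α : Fin n → ((Fin m → ℝ) →ₗ[ℝ] ℝ)) (t : Fin m → ℝ)
    (w z : Fin n → ℂ) : star (act α t w) ⬝ᵥ z = star w ⬝ᵥ act α (-t) z := by
  unfold dotProduct
  refine Finset.sum_congr rfl fun k _ => ?_
  simp only [act, Pi.star_apply, RCLike.star_def, map_mul, ← Complex.exp_conj, map_neg,
    Complex.conj_I, Complex.conj_ofReal, Complex.ofReal_neg, neg_mul, mul_neg]
  ring

theorem integral_comp_act {m n : ℕ} (lam : ℝ) (α : Fin n → ((Fin m → ℝ) →ₗ[ℝ] ℝ))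
    (t : Fin m → ℝ) (u : (Fin n → ℂ) → ℝ) :
    ∫ z, u (act α t z) ∂(muFock n lam) = ∫ z, u z ∂(muFock n lam) := by
  simp only [act_eq_circle_mul]
  exact (measurePreserving_circle_mul lam _).integral_comp (measurableEmbedding_circle_mul _) u

/-- The operator `f ↦ f (t⁻¹ · z)` on the Fock space. -/
noncomputable def tau {m n : ℕ} (α : Fin n → ((Fin m → ℝ) →ₗ[ℝ] ℝ)) (lam : ℝ) (t : Fin m → ℝ) :
    Fock n lam →ₗ[ℂ] Fock n lam where
  toFun f := ⟨fun z => f (act α (-t) z), by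
    refine ⟨f.differentiable.comp (by unfold act; fun_prop), ?_⟩
    have h := ((measurePreserving_circle_mul lam fun k => Circle.exp (α k (-t))).integrable_comp_emb
      (measurableEmbedding_circle_mul _)).2 f.integrable
    refine h.congr (Eventually.of_forall fun z => ?_)
    simp only [Function.comp, absSq_circle_mul, act_eq_circle_mul]⟩
  map_add' _ _ := rfl
  map_smul' _ _ := rfl

section tau

variable {m n : ℕ} (α : Fin n → ((Fin m → ℝ) →ₗ[ℝ] ℝ)) (lam : ℝ)

theorem tau_apply (t : Fin m → ℝ) (f : Fock n lam) (z : Fin n → ℂ) :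
    tau α lam t f z = f (act α (-t) z) := rfl

theorem tau_zero (f : Fock n lam) : tau α lam 0 f = f := by
  ext z
  rw [tau_apply, neg_zero, act_zero]

theorem tau_add (s t : Fin m → ℝ) (f : Fock n lam) :
    tau α lam (s + t) f = tau α lam s (tau α lam t f) := by
  ext z
  rw [tau_apply, tau_apply, tau_apply, act_act, neg_add_rev]

theorem norm_tau [Fact (0 < lam)] (t : Fin m → ℝ) (f : Fock n lam) : ‖tau α lam t f‖ = ‖f‖ := by
  refine (sq_eq_sq₀ (norm_nonneg _) (norm_nonneg _)).1 ?_
  rw [Fock.norm_sq_eq, Fock.norm_sq_eq,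
    ← integral_comp_act lam α (-t) fun z => ‖f z‖ ^ 2 * Real.exp (-lam * absSq z / 2)]
  simp only [absSq_act, tau_apply]

/-- This covariance is what matches the semidirect product law. -/
theorem tau_rho (t : Fin m → ℝ) (h : Heisenberg n) (f : Fock n lam) :
    tau α lam t (rho lam h f) = rho lam (actH α t h) (tau α lam t f) := by
  ext z
  simp only [tau_apply, rho_apply, actH, star_act_dotProduct, absSq_act, act_sub, act_act,
    neg_add_cancel, act_zero]

end tau

/-! ### The representation of the Heisenberg group -/

section rho

variable {n : ℕ} (lam : ℝ)

theorem absSq_zero : absSq (0 : Fin n → ℂ) = 0 := by simp [absSq]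

theorem absSq_neg (z : Fin n → ℂ) : absSq (-z) = absSq z := by simp [absSq]

theorem rho_one (f : Fock n lam) : rho lam 1 f = f := by
  ext z
  simp [rho_apply, absSq_zero]

theorem rho_mul (h k : Heisenberg n) (f : Fock n lam) :
    rho lam (h * k) f = rho lam h (rho lam k f) := by
  ext z
  simp only [rho_apply, Heisenberg.mul_z, Heisenberg.mul_c, ← mul_assoc, ← Complex.exp_add,
    sub_sub]
  congr 2
  have h1 : absSq (h.z + k.z) = absSq h.z + 2 * (star k.z ⬝ᵥ h.z).re + absSq k.z := by
    have := absSq_sub h.z (-k.z)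
    simpa [absSq_neg] using this
  have h2 : omegaRe h.z k.z = -(star k.z ⬝ᵥ h.z).im := by
    rw [omegaRe_eq, dotProduct_comm]
  -- The real part comes from expanding `absSq (h.z + k.z)`, the imaginary part from the cocycle
  -- `omegaRe`; together they give the term that shifting `z` by `h.z` produces in the exponent of
  -- `rho lam k`.
  have h3 := Complex.re_add_im (star k.z ⬝ᵥ h.z)
  rw [h1, h2, star_add, add_dotProduct, dotProduct_sub]
  push_cast
  linear_combination (-(lam : ℂ) / 2) * h3

/-- The squared modulus of the multiplier turns the Gaussian weight at `z` into the weight at `z -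
h.z`; translation invariance of Lebesgue measure does the rest. -/
theorem norm_rho [Fact (0 < lam)] (h : Heisenberg n) (f : Fock n lam) : ‖rho lam h f‖ = ‖f‖ := by
  refine (sq_eq_sq₀ (norm_nonneg _) (norm_nonneg _)).1 ?_
  have hm : MeasurePreserving (fun z : Fin n → ℂ => z - h.z) (muFock n lam) (muFock n lam) :=
    (measurePreserving_sub_right volume h.z).smul_measure _
  rw [Fock.norm_sq_eq, Fock.norm_sq_eq, 
    ← hm.integral_comp (measurableEmbedding_subRight h.z)
      fun z => ‖f z‖ ^ 2 * Real.exp (-lam * absSq z / 2)]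
  congr 1
  ext z
  rw [rho_apply, norm_mul, mul_pow, Complex.norm_exp, ← Real.exp_nat_mul, mul_right_comm,
    ← Real.exp_add, mul_comm, absSq_sub]
  congr 2
  have e1 : (Complex.I * lam * h.c).re = 0 := by simp
  have e2 : ((lam : ℂ) / 2 * (star h.z ⬝ᵥ z)).re = lam / 2 * (star h.z ⬝ᵥ z).re := by
    rw [show (lam : ℂ) / 2 = ((lam / 2 : ℝ) : ℂ) by push_cast; rfl, Complex.re_ofReal_mul]
  have e3 : ((lam : ℂ) / 4 * absSq h.z).re = lam / 4 * absSq h.z := by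
    rw [show (lam : ℂ) / 4 = ((lam / 4 : ℝ) : ℂ) by push_cast; rfl, Complex.re_ofReal_mul,
      Complex.ofReal_re]
  rw [Complex.sub_re, Complex.add_re, e1, e2, e3]
  push_cast
  ring

theorem inner_rho_rho [Fact (0 < lam)] (h : Heisenberg n) (f g : Fock n lam) :
    inner ℂ (rho lam h f) (rho lam h g) = inner ℂ f g :=
  LinearIsometry.inner_map_map ⟨rho lam h, norm_rho lam h⟩ f g

theorem inner_rho_left [Fact (0 < lam)] (h : Heisenberg n) (f g : Fock n lam) :
    inner ℂ (rho lam h f) g = inner ℂ f (rho lam h⁻¹ g) := by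
  rw [← inner_rho_rho lam h f, ← rho_mul, mul_inv_cancel, rho_one]

end rho

/-! ### The reproducing property -/

namespace Fock

variable {n : ℕ} {lam : ℝ}

theorem integrable_exp_absSq [hl : Fact (0 < lam)] :
    Integrable (fun z : Fin n → ℂ => Real.exp (-lam * absSq z / 2)) (muFock n lam) := by
  have hb : 0 < ((lam / 2 : ℝ) : ℂ).re := by
    simpa using hl.out
  have h1 : Integrable (fun v : ℂ => Real.exp (-(lam / 2) * ‖v‖ ^ 2)) := by
    refine (GaussianFourier.integrable_cexp_neg_mul_sq_norm_add (V := ℂ) hb 0 0).norm.congr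
      (Eventually.of_forall fun v => ?_)
    simp only [Complex.norm_exp]
    congr 1
    rw [zero_mul, add_zero, ← Complex.ofReal_pow, ← Complex.ofReal_neg, ← Complex.ofReal_mul,
      Complex.ofReal_re]
  have h2 : Integrable (fun z : Fin n → ℂ => ∏ k, Real.exp (-(lam / 2) * ‖z k‖ ^ 2)) volume :=
    Integrable.fintype_prod fun _ => h1
  refine Integrable.smul_measure (h2.congr (Eventually.of_forall fun z => ?_))
    ENNReal.ofReal_ne_top
  simp only [← Real.exp_sum, absSq, ← Finset.mul_sum]
  ring_nf

/-- The constant function `1`. -/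
noncomputable def vacuum (n : ℕ) (lam : ℝ) [Fact (0 < lam)] : Fock n lam :=
  ⟨fun _ => 1, differentiable_const 1, by simpa using integrable_exp_absSq⟩

@[simp] theorem vacuum_apply [Fact (0 < lam)] (z : Fin n → ℂ) : vacuum n lam z = 1 := rfl

theorem vacuum_ne_zero [Fact (0 < lam)] : vacuum n lam ≠ 0 := fun h => by
  simpa using congrArg (fun f : Fock n lam => f 0) h

/-- The mean value property on the circle `θ ↦ e^{iθ} z`. -/
theorem intervalIntegral_rotation (f : Fock n lam) (z : Fin n → ℂ) :
    ∫ θ in (0 : ℝ)..2 * Real.pi, f (fun k => (Circle.exp θ : ℂ) * z k)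
      = 2 * Real.pi * f 0 := by
  have hd : Differentiable ℂ fun s : ℂ => f (s • z) := f.differentiable.comp (by fun_prop)
  have h := (hd.diffContOnCl (s := Metric.ball 0 |1|)).circleAverage
  rw [Real.circleAverage_def, inv_smul_eq_iff₀ (by positivity)] at h
  simpa [circleMap, Pi.smul_def] using h

/-- Leaving `φ` arbitrary covers both the integrand of `inner_vacuum` and its norm. -/
theorem integral_rotation (f : Fock n lam) (θ : ℝ) (φ : ℂ → ℝ → ℂ) :
    ∫ z, φ (f fun k => (Circle.exp θ : ℂ) * z k) (Real.exp (-lam * absSq z / 2)) ∂(muFock n lam)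
      = ∫ z, φ (f z) (Real.exp (-lam * absSq z / 2)) ∂(muFock n lam) := by
  rw [← (measurePreserving_circle_mul lam fun _ => Circle.exp θ).integral_comp
    (measurableEmbedding_circle_mul _) fun z => φ (f z) (Real.exp (-lam * absSq z / 2))]
  simp only [absSq_circle_mul]

/-- The measure is rotation invariant, so `f` may be replaced by its average over `θ ↦ e^{iθ} z`,
which is `f 0`; Fubini exchanges the two integrals. The total Gaussian mass stays unevaluated as
`‖vacuum n lam‖ ^ 2`, since only its being nonzero matters. -/
theorem inner_vacuum [Fact (0 < lam)] (f : Fock n lam) :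
    inner ℂ (vacuum n lam) f = (‖vacuum n lam‖ ^ 2 : ℝ) * f 0 := by
  let F : ℝ → (Fin n → ℂ) → ℂ := fun θ z =>
    f (fun k => (Circle.exp θ : ℂ) * z k) * (Real.exp (-lam * absSq z / 2) : ℂ)
  have hfint : Integrable (fun z => f z * (Real.exp (-lam * absSq z / 2) : ℂ)) (muFock n lam) := by
    simpa using integrable_inner (vacuum n lam) f
  have hinner : inner ℂ (vacuum n lam) f
      = ∫ z, f z * (Real.exp (-lam * absSq z / 2) : ℂ) ∂(muFock n lam) := by
    simp [inner_def]
  have hF : ∀ θ, ∫ z, F θ z ∂(muFock n lam) = inner ℂ (vacuum n lam) f := fun θ => by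
    rw [hinner]
    exact integral_rotation f θ fun a b => a * (b : ℂ)
  have hsf : SFinite (muFock n lam) := by unfold muFock; infer_instance
  have hcont : Continuous (Function.uncurry F) := by
    have := f.differentiable.continuous
    unfold F absSq Function.uncurry
    fun_prop
  have hint : Integrable (Function.uncurry F)
      ((volume.restrict (Set.uIoc 0 (2 * Real.pi))).prod (muFock n lam)) := by
    rw [integrable_prod_iff hcont.aestronglyMeasurable]
    constructor
    · refine Eventually.of_forall fun θ => ?_
      refine (((measurePreserving_circle_mul lam fun _ => Circle.exp θ).integrable_comp_emb
        (measurableEmbedding_circle_mul _)).2 hfint).congr (Eventually.of_forall fun z => ?_)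
      simp only [Function.comp, absSq_circle_mul, F, Function.uncurry]
    -- The integral of the norm does not depend on `θ`, so it is integrable over a bounded interval.
    · have hc : ∀ θ, ∫ z, ‖Function.uncurry F (θ, z)‖ ∂(muFock n lam)
          = ∫ z, ‖f z * (Real.exp (-lam * absSq z / 2) : ℂ)‖ ∂(muFock n lam) := fun θ => by
        refine Complex.ofReal_injective ?_
        rw [← integral_complex_ofReal, ← integral_complex_ofReal]
        exact integral_rotation f θ fun a b => (‖a * (b : ℂ)‖ : ℝ)
      simp only [hc]
      exact integrableOn_const measure_Ioc_lt_top.ne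
  have hswap := intervalIntegral_integral_swap hint
  simp only [hF, F, intervalIntegral.integral_mul_const, intervalIntegral_rotation,
    integral_const_mul, intervalIntegral.integral_const, sub_zero] at hswap
  have hmass : ∫ z, (Real.exp (-lam * absSq z / 2) : ℂ) ∂(muFock n lam)
      = (‖vacuum n lam‖ ^ 2 : ℝ) := by
    rw [norm_sq_eq, ← integral_complex_ofReal]
    simp
  rw [hmass, Complex.real_smul] at hswap
  have hpi : (2 * Real.pi : ℂ) ≠ 0 := by
    simp [Real.pi_ne_zero]
  push_cast at hswap ⊢
  refine mul_left_cancel₀ hpi (hswap.trans ?_)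
  ring

/-- Moving `rho` to the other side reduces evaluation at `w` to evaluation at `0` of a translate of
`f`. -/
theorem inner_rho_vacuum [Fact (0 < lam)] (w : Fin n → ℂ) (f : Fock n lam) :
    inner ℂ (rho lam ⟨w, 0⟩ (vacuum n lam)) f
      = (‖vacuum n lam‖ ^ 2 * Real.exp (-lam / 4 * absSq w) : ℝ) * f w := by
  rw [inner_rho_left, inner_vacuum, rho_apply]
  simp [absSq_neg]
  ring_nf

end Fock

/-! ### Schur's lemma for the Fock representation -/

/-- A function on `ℂ` which is both holomorphic and antiholomorphic is constant. -/
theorem eq_of_differentiable_of_eq_conj {g g' : ℂ → ℂ} (hg : Differentiable ℂ g)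
    (hg' : Differentiable ℂ g') (h : ∀ s, g s = (starRingEnd ℂ) (g' s)) (s : ℂ) :
    g s = g 0 := by
  refine is_const_of_deriv_eq_zero hg (fun x => ?_) s 0
  have h1 := ((hg x).hasFDerivAt.restrictScalars ℝ)
  have h2 : HasFDerivAt g _ x :=
    (((Complex.conjCLE : ℂ →L[ℝ] ℂ).hasFDerivAt.comp x
      ((hg' x).hasFDerivAt.restrictScalars ℝ)).congr_of_eventuallyEq
      (Eventually.of_forall fun s => h s))
  have h3 := h1.unique h2
  -- With `a`, `b` the derivatives of `g`, `g'` at `x`, direction `1` gives `a = conj b` and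
  -- direction `I` gives `I a = -I conj b`; hence `2 I a = 0`.
  have e1 := congrArg (fun L => L 1) h3
  have eI := congrArg (fun L => L Complex.I) h3
  have k1 : ∀ (φ : ℂ → ℂ), fderiv ℂ φ x Complex.I = Complex.I * fderiv ℂ φ x 1 := fun φ => by
    rw [← smul_eq_mul, ← map_smul, smul_eq_mul, mul_one]
  simp only [ContinuousLinearMap.coe_restrictScalars', ContinuousLinearMap.comp_apply,
    ContinuousLinearEquiv.coe_coe, Complex.conjCLE_apply, k1, map_mul, Complex.conj_I] at e1 eI
  rw [← fderiv_apply_one_eq_deriv]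
  have : 2 * Complex.I * fderiv ℂ g x 1 = 0 := by linear_combination eI + Complex.I * e1
  simpa using this

/-- Once `U` multiplies the vacuum by a scalar, it does so for every coherent state, and pairing
with these recovers every value of `U f`. -/
theorem exists_eq_smul_of_commute_rho {n : ℕ} {lam : ℝ} [Fact (0 < lam)]
    (U : Fock n lam ≃ₗᵢ[ℂ] Fock n lam) (hU : ∀ h f, U (rho lam h f) = rho lam h (U f)) :
    ∃ c : Circle, ∀ f, U f = (c : ℂ) • f := by
  set v := Fock.vacuum n lam with hv
  have hv0 : ‖v‖ ≠ 0 := norm_ne_zero_iff.2 Fock.vacuum_ne_zero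
  have hU' : ∀ h f, U.symm (rho lam h f) = rho lam h (U.symm f) := fun h f => by
    rw [LinearIsometryEquiv.symm_apply_eq, hU, LinearIsometryEquiv.apply_symm_apply]
  have hC : ∀ w : Fin n → ℂ,
      ((‖v‖ ^ 2 * Real.exp (-lam / 4 * absSq w) : ℝ) : ℂ) ≠ 0 := fun w => by
    rw [Complex.ofReal_ne_zero]
    positivity
  -- Both sides are coherent-state pairings: `⟨ρ(w)v, Uv⟩ = ⟨ρ(w)U⁻¹v, v⟩ = ⟨U⁻¹v, ρ(-w)v⟩`.
  have hg : ∀ w, U v w = (starRingEnd ℂ) (U.symm v (-w)) := fun w => by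
    have h1 : inner ℂ (rho lam ⟨w, 0⟩ v) (U v)
        = (starRingEnd ℂ) (inner ℂ (rho lam ⟨-w, 0⟩ v) (U.symm v)) := by
      rw [inner_conj_symm, ← LinearIsometryEquiv.inner_map_map U.symm, hU',
        LinearIsometryEquiv.symm_apply_apply, inner_rho_left]
      congr 3
      ext1 <;> simp
    rw [Fock.inner_rho_vacuum, Fock.inner_rho_vacuum, map_mul, Complex.conj_ofReal, absSq_neg] at h1
    exact mul_left_cancel₀ (hC w) h1
  have hconst : U v = (U v 0) • v := by
    ext w
    -- Restriction to the complex line through `0` and `w` reduces the claim to one variable.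
    have := eq_of_differentiable_of_eq_conj (g := fun s => U v (s • w))
      (g' := fun s => U.symm v (-(s • w)))
      ((U v).differentiable.comp (by fun_prop))
      ((U.symm v).differentiable.comp (by fun_prop)) (fun s => hg (s • w)) 1
    simpa [hv] using this
  have hnorm : ‖U v 0‖ = 1 := by
    have h1 := congrArg norm hconst
    rw [LinearIsometryEquiv.norm_map, norm_smul] at h1
    exact mul_right_cancel₀ hv0 (by rw [← h1, one_mul])
  refine ⟨⟨U v 0, mem_sphere_zero_iff_norm.2 hnorm⟩, fun f => ?_⟩
  ext w
  have h1 : inner ℂ (rho lam ⟨w, 0⟩ v) f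
      = (starRingEnd ℂ) (U v 0) * inner ℂ (rho lam ⟨w, 0⟩ v) (U f) := by
    rw [← LinearIsometryEquiv.inner_map_map U, hU]
    conv_lhs => rw [hconst]
    rw [map_smul, inner_smul_left]
  rw [Fock.inner_rho_vacuum, Fock.inner_rho_vacuum, mul_left_comm] at h1
  have h2 := mul_left_cancel₀ (hC w) h1
  have h3 : U v 0 * (starRingEnd ℂ) (U v 0) = 1 := by
    rw [Complex.mul_conj', hnorm]
    simp
  show U f w = U v 0 * f w
  rw [h2, ← mul_assoc, h3, one_mul]

/-! ### The representations of the diamond group -/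

section diamond

variable {m n : ℕ} {α : Fin n → ((Fin m → ℝ) →ₗ[ℝ] ℝ)} {lam : ℝ}
  {σ : (Fin m → ℝ) → (Fock n lam →ₗ[ℂ] Fock n lam)}

theorem piOp_apply (g : Diamond α) (f : Fock n lam) :
    piOp α lam σ g f = rho lam g.h (σ g.t f) := rfl

theorem Diamond.continuous_coords :
    Continuous fun g : Diamond α => (g.t, g.h.z, g.h.c) := continuous_induced_dom

/-- Dominated convergence along `𝓝 g₀` needs a countably generated filter. -/
instance : FirstCountableTopology (Diamond α) :=
  Topology.IsInducing.firstCountableTopology (f := fun g : Diamond α => (g.t, g.h.z, g.h.c)) ⟨rfl⟩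

/-- The operators `f ↦ f (t⁻¹ · z)` as unitary operators. -/
noncomputable def tauEquiv (α : Fin n → ((Fin m → ℝ) →ₗ[ℝ] ℝ)) (lam : ℝ) [Fact (0 < lam)]
    (t : Fin m → ℝ) : Fock n lam ≃ₗᵢ[ℂ] Fock n lam where
  toLinearEquiv := LinearEquiv.ofLinearMap (tau α lam t) (tau α lam (-t))
    (by ext1 f; simp [← tau_add, tau_zero]) (by ext1 f; simp [← tau_add, tau_zero])
  norm_map' := norm_tau α lam t

theorem isUnitaryRep_piOp [Fact (0 < lam)] {χ : AddChar (Fin m → ℝ) Circle} (hχ : Continuous χ)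
    (hσ : ∀ t f, σ t f = (χ t : ℂ) • tau α lam t f) : IsUnitaryRep (piOp α lam σ) := by
  have hone : piOp α lam σ 1 = LinearMap.id := by
    ext1 f
    simp [piOp_apply, hσ, tau_zero, rho_one]
  have hmul : ∀ g g', piOp α lam σ (g * g') = piOp α lam σ g ∘ₗ piOp α lam σ g' := fun g g' => by
    ext1 f
    simp only [piOp_apply, hσ, LinearMap.comp_apply, Diamond.mul_h, Diamond.mul_t, rho_mul,
      tau_add, map_smul, tau_rho, smul_smul, AddChar.map_add_eq_mul, Circle.coe_mul]
    rw [mul_comm]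
  have hnorm : ∀ g f, ‖piOp α lam σ g f‖ = ‖f‖ := fun g f => by
    rw [piOp_apply, hσ, norm_rho, norm_smul, norm_tau, Circle.norm_coe, one_mul]
  refine ⟨hone, hmul, fun g => ⟨⟨LinearEquiv.ofLinearMap (piOp α lam σ g) (piOp α lam σ g⁻¹)
    (by rw [← hmul, mul_inv_cancel, hone]) (by rw [← hmul, inv_mul_cancel, hone]), hnorm g⟩,
    fun f => rfl⟩, fun f => ?_⟩
  refine continuous_iff_continuousAt.2 fun g₀ =>
    Fock.tendsto_of_pointwise_of_norm_eq (fun z => ?_) fun g => by rw [hnorm, hnorm]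
  have hf := f.differentiable.continuous
  have ht : Continuous fun g : Diamond α => g.t := Diamond.continuous_coords.fst
  have hz : Continuous fun g : Diamond α => g.h.z := Diamond.continuous_coords.snd.fst
  have hc : Continuous fun g : Diamond α => g.h.c := Diamond.continuous_coords.snd.snd
  have hα : ∀ k, Continuous (α k) := fun k => (α k).continuous_of_finiteDimensional
  have : Continuous fun g : Diamond α => piOp α lam σ g f z := by
    simp only [piOp_apply, hσ, rho_apply, Fock.smul_apply, tau_apply, dotProduct, absSq]
    unfold act
    fun_prop
  exact this.tendsto g₀

theorem IsUnitaryRep.exists_char [Fact (0 < lam)] (hπ : IsUnitaryRep (piOp α lam σ)) :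
    ∃ χ : AddChar (Fin m → ℝ) Circle, Continuous χ ∧
      ∀ t f, σ t f = (χ t : ℂ) • tau α lam t f := by
  have hpi : ∀ t f, piOp α lam σ ⟨t, 1⟩ f = σ t f := fun t f => rho_one lam _
  have h0 : ∀ f, σ 0 f = f := fun f => by
    rw [← hpi]
    exact LinearMap.congr_fun hπ.map_one f
  have hadd : ∀ s t f, σ (s + t) f = σ s (σ t f) := fun s t f => by
    have h := LinearMap.congr_fun (hπ.map_mul ⟨s, 1⟩ ⟨t, 1⟩) f
    rw [LinearMap.comp_apply, hpi, hpi] at h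
    rw [← h, ← hpi]
    congr 2
    apply Diamond.ext <;> simp [actH_one]
  -- This is the product `(t, 1)(0, h) = (t, t · h)` read through `π`.
  have hcomm : ∀ t h f, σ t (rho lam h f) = rho lam (actH α t h) (σ t f) := fun t h f => by
    have h1 := LinearMap.congr_fun (hπ.map_mul ⟨t, 1⟩ ⟨0, h⟩) f
    rw [LinearMap.comp_apply, hpi, piOp_apply, piOp_apply] at h1
    simpa [h0] using h1.symm
  have hex : ∀ t, ∃ c : Circle, ∀ f, σ t f = (c : ℂ) • tau α lam t f := fun t => by
    obtain ⟨U, hU⟩ := hπ.unitary ⟨t, 1⟩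
    have hA : ∀ f, (U.trans (tauEquiv α lam (-t))) f = tau α lam (-t) (σ t f) := fun f => by
      rw [← hpi, hU]
      rfl
    -- In `tau (-t) ∘ σ t` the two twists `h ↦ t · h` and `h ↦ (-t) · h` cancel, so Schur's lemma
    -- applies.
    obtain ⟨c, hc⟩ := exists_eq_smul_of_commute_rho (U.trans (tauEquiv α lam (-t)))
      fun h f => by
        rw [hA, hA, hcomm, tau_rho, actH_actH, neg_add_cancel, actH_zero]
    refine ⟨c, fun f => ?_⟩
    rw [← map_smul, ← hc, hA, ← tau_add, add_neg_cancel, tau_zero]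
  choose c hc using hex
  let v := Fock.vacuum n lam
  -- Rotations fix the constant function, so `c` is an eigenvalue on a single vector, from which
  -- multiplicativity and continuity are read off.
  have hcv : ∀ t, σ t v = (c t : ℂ) • v := fun t => hc t v
  have hv : v ≠ 0 := Fock.vacuum_ne_zero
  let χ : AddChar (Fin m → ℝ) Circle :=
    { toFun := c
      map_zero_eq_one' := by
        have h := hcv 0
        rw [h0] at h
        exact Circle.ext (smul_left_injective ℂ hv (by simpa using h.symm))
      map_add_eq_mul' := fun s t => by
        have h := hcv (s + t)
        rw [hadd, hcv, map_smul, hcv, smul_smul] at h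
        refine Circle.ext (smul_left_injective ℂ hv ?_)
        simpa [mul_comm] using h.symm }
  refine ⟨χ, ?_, hc⟩
  have hcont : Continuous fun t : Fin m → ℝ => σ t v := by
    have h1 : Continuous fun t : Fin m → ℝ => (⟨t, 1⟩ : Diamond α) :=
      continuous_induced_rng.2 (by
        show Continuous fun t : Fin m → ℝ => (t, (0 : Fin n → ℂ), (0 : ℝ))
        fun_prop)
    exact ((hπ.continuous v).comp h1).congr fun t => hpi t v
  refine continuous_induced_rng.2 ?_
  have hvv : inner ℂ v v ≠ 0 := inner_self_ne_zero.2 hv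
  -- The quotient equals `c t`, a matrix coefficient of the strongly continuous `π`.
  have h2 : Continuous fun t => inner ℂ v (σ t v) / inner ℂ v v :=
    (continuous_const.inner hcont).div_const _
  refine h2.congr fun t => ?_
  rw [hcv, inner_smul_right, mul_div_cancel_right₀ _ hvv]
  rfl

end diamond

theorem mainTheorem1 {m n : ℕ} (α : Fin n → ((Fin m → ℝ) →ₗ[ℝ] ℝ))
    (lam : ℝ) [Fact (0 < lam)] (σ : (Fin m → ℝ) → (Fock n lam →ₗ[ℂ] Fock n lam)) :
    (IsUnitaryRep (piOp α lam σ) ↔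
      ∃ χ : AddChar (Fin m → ℝ) Circle, Continuous χ ∧
        ∀ (t : Fin m → ℝ) (f : Fock n lam) (z : Fin n → ℂ),
          σ t f z = (χ t : ℂ) * f (act α (-t) z)) ∧
    (∀ χ : AddChar (Fin m → ℝ) Circle, Continuous χ →
      (∀ (t : Fin m → ℝ) (f : Fock n lam) (z : Fin n → ℂ),
        σ t f z = (χ t : ℂ) * f (act α (-t) z)) →
      ∀ (t : Fin m → ℝ) (z₀ : Fin n → ℂ) (c₀ : ℝ) (f : Fock n lam) (z : Fin n → ℂ),
        piOp α lam σ ⟨t, ⟨z₀, c₀⟩⟩ f z =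
          (χ t : ℂ) * Complex.exp (Complex.I * lam * c₀ + lam / 2 * (star z₀ ⬝ᵥ z)
            - lam / 4 * absSq z₀) * f (act α (-t) (z - z₀))) := by

  have hiff : ∀ χ : AddChar (Fin m → ℝ) Circle,
      (∀ t f z, σ t f z = (χ t : ℂ) * f (act α (-t) z)) ↔
        ∀ t f, σ t f = (χ t : ℂ) • tau α lam t f :=
    fun χ => ⟨fun h t f => Fock.ext (h t f), fun h t f z => by rw [h]; rfl⟩
  refine ⟨⟨fun h => ?_, fun ⟨χ, hχ, h⟩ => isUnitaryRep_piOp hχ ((hiff χ).1 h)⟩,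
    fun χ _ h t z₀ c₀ f z => ?_⟩
  · obtain ⟨χ, hχ, h⟩ := h.exists_char
    exact ⟨χ, hχ, (hiff χ).2 h⟩
  · rw [piOp_apply, rho_apply, h]
    ring
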